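/- All graphs are finite and simple. A graph is $4$-connected if it has more than four vertices and the deletion of any set of fewer than four vertices leaves it connected. A $K_4$-model of a graph $G$ is a map $f : V(G) \to V(K_4)$ such that for each label $i \in V(K_4)$ the subgraph of $G$ induced on $f^{-1}(i)$ is nonempty and connected, and for any two distinct labels $i, j$ there is an edge of $G$ between $f^{-1}(i)$ and $f^{-1}(j)$. The reconfiguration graph of $G$ has the $K_4$-models of $G$ as its nodes, two models being adjacent when they differ in the label of exactly one vertex of $G$; $G \in \mathrm{host}(K_4)$ means that this reconfiguration graph is nonempty and connected. To split a vertex $v$ of $G$ into $x$ and $y$ is to delete $v$ and add two new vertices $x$ and $y$ that are adjacent to each other, such that each neighbour of $v$ in $G$ becomes a neighbour of exactly one of $x$ and $y$, there are no further new edges, and $x$ and $y$ each have degree at least $3$ in the resulting graph. Lemma. Let $G$ be a $4$-connected graph with $G \in \mathrm{host}(K_4)$, and let $G'$ be a $4$-connected graph obtained from $G$ by splitting a vertex $v$ into vertices $x$ and $y$. Then $G' \in \mathrm{host}(K_4)$. -/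

import Mathlib

namespace MinorReconfiguration

/-- `G` is `k`-connected: it has more than `k` vertices, and deleting fewer than `k` vertices
never disconnects it. -/
def IsKConnected {V : Type*} (k : ℕ) (G : SimpleGraph V) : Prop :=
  (k : ℕ∞) < ENat.card V ∧
    ∀ S : Set V, S.encard < (k : ℕ∞) → (G.induce Sᶜ).Connected

/-- The branch set of the label `i`: the subgraph of `G` induced on the vertices labelled `i`. -/
abbrev branchSet {V W : Type*} (G : SimpleGraph V) (f : V → W) (i : W) :
    SimpleGraph {u : V | f u = i} :=
  G.induce {u : V | f u = i}

/-- `f` is an `H`-model of `G`: every branch set is nonempty and connected (`SimpleGraph.Connected`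
includes nonemptiness), and for every edge `ij` of `H` some edge of `G` joins the branch sets
of `i` and `j`. -/
structure IsModel {V W : Type*} (H : SimpleGraph W) (G : SimpleGraph V) (f : V → W) : Prop where
  branchSet_connected : ∀ i : W, (branchSet G f i).Connected
  exists_edge : ∀ i j : W, H.Adj i j → ∃ u w : V, f u = i ∧ f w = j ∧ G.Adj u w

/-- The reconfiguration graph: its nodes are the `H`-models of `G`, and two models are adjacent
when they differ in the label of exactly one vertex of `G`. -/
def reconfigurationGraph {V W : Type*} (H : SimpleGraph W) (G : SimpleGraph V) :
    SimpleGraph {f : V → W // IsModel H G f} where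
  Adj f g := ∃! u : V, f.1 u ≠ g.1 u
  symm := ⟨fun f g h => by simpa only [ne_comm] using h⟩
  loopless := ⟨fun f h => by
    obtain ⟨u, hu, -⟩ := h
    exact hu rfl⟩

/-- `G ∈ host(H)`: the reconfiguration graph of the `H`-models of `G` is connected (in particular
`H` is a minor of `G`). -/
def InHost {V W : Type*} (H : SimpleGraph W) (G : SimpleGraph V) : Prop :=
  (reconfigurationGraph H G).Connected

/-- `G'` is obtained from `G` by splitting the vertex `v` into the vertices `x` and `y`.
The bijection `e` identifies the vertices of `G` other than `v` with those of `G'` other than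
`x` and `y`. -/
def IsVertexSplit {V V' : Type*} (G : SimpleGraph V) (G' : SimpleGraph V') (v : V) (x y : V') :
    Prop :=
  G'.Adj x y ∧
  3 ≤ (G'.neighborSet x).encard ∧
  3 ≤ (G'.neighborSet y).encard ∧
  ∃ e : {u : V // u ≠ v} ≃ {w : V' // w ≠ x ∧ w ≠ y},
    (∀ a b : {u : V // u ≠ v}, G'.Adj (e a) (e b) ↔ G.Adj a b) ∧
    (∀ a : {u : V // u ≠ v}, G.Adj v a → Xor (G'.Adj x (e a)) (G'.Adj y (e a))) ∧
    (∀ a : {u : V // u ≠ v}, ¬ G.Adj v a → ¬ G'.Adj x (e a) ∧ ¬ G'.Adj y (e a))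

end MinorReconfiguration

/-! Contracting the edge `xy` gives a map `φ : V' → V` whose fibres are cliques, so the models of
`G'` in which `x` and `y` share a label are exactly the composites `g ∘ φ` with `g` a model of `G`
(`IsContraction.isK4Model_comp`). The proof has two halves.

Merging (`IsModel.merge`): since `G'` is 4-connected, every model of `G'` reconfigures to one with
equal labels on `x` and `y`. The branch sets of `x` and then of `y` are shrunk to single vertices,
unless a merge happens on the way. Then `x` has at least four neighbours, so two of them lie in one
third branch set, and this surplus makes room for a merge. The shrinking rests on
`SetConnected.exists_noncut`, which finds a vertex that can leave its branch set without
disconnecting it.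

Lifting (`IsContraction.reconfigurable_comp`): a walk between models of `G` lifts to `G'`. Only a
relabelling of `v` needs care, as `x` and `y` must move one at a time
(`reconfigurable_of_eqOn_pair`).

Hence every model of `G'` reaches one fixed composite `g₀ ∘ φ`. -/

namespace MinorReconfiguration

open Function

/-! ### Connected vertex sets and non-cut vertices. -/

/-- A vertex set is nonempty and every proper nonempty part of it sends an edge to the rest. -/
def SetConnected {V : Type*} (G : SimpleGraph V) (B : Set V) : Prop :=
  B.Nonempty ∧ ∀ S ⊆ B, S.Nonempty → S ≠ B → ∃ p ∈ S, ∃ q ∈ B, q ∉ S ∧ G.Adj p q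

/-- The cut form of connectivity avoids walks in subtypes: each later argument only needs one edge
leaving a proper part. -/
theorem induce_connected_iff {V : Type*} {G : SimpleGraph V} {B : Set V} :
    (G.induce B).Connected ↔ SetConnected G B := by
  constructor
  · intro h
    obtain ⟨⟨b, hb⟩⟩ := h.nonempty
    refine ⟨⟨b, hb⟩, fun S hS ⟨s, hs⟩ hne => ?_⟩
    obtain ⟨t, ht, hts⟩ := Set.exists_of_ssubset (hS.ssubset_of_ne hne)
    obtain ⟨w⟩ := h.preconnected ⟨s, hS hs⟩ ⟨t, ht⟩
    obtain ⟨d, -, h1, h2⟩ := w.exists_boundary_dart {p | p.1 ∈ S} hs hts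
    exact ⟨_, h1, _, d.snd.2, h2, d.adj⟩
  · rintro ⟨⟨b, hb⟩, h⟩
    refine (SimpleGraph.connected_iff_exists_forall_reachable _).2 ⟨⟨b, hb⟩, ?_⟩
    by_contra! hcon
    obtain ⟨⟨t, ht⟩, hbt⟩ := hcon
    obtain ⟨p, ⟨hp, hbp⟩, q, hq, hqS, hpq⟩ :=
      h {p | ∃ hp : p ∈ B, (G.induce B).Reachable ⟨b, hb⟩ ⟨p, hp⟩} (fun p hp => hp.1)
        ⟨b, hb, .rfl⟩ (fun he => hbt (he.symm.subset ht).2)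
    refine hqS ⟨hq, hbp.trans (SimpleGraph.Adj.reachable ?_)⟩
    exact hpq

theorem SetConnected.insert {V : Type*} {G : SimpleGraph V} {B : Set V} (hB : SetConnected G B)
    {u w : V} (hw : w ∈ B) (h : G.Adj u w) : SetConnected G (insert u B) := by
  refine ⟨⟨u, .inl rfl⟩, fun S hS hne hS' => ?_⟩
  by_cases hBS : B ⊆ S
  · have hu : u ∉ S := fun hu => hS' (hS.antisymm (Set.insert_subset hu hBS))
    exact ⟨w, hBS hw, u, .inl rfl, hu, h.symm⟩
  · by_cases hSB : (S ∩ B).Nonempty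
    · obtain ⟨p, hp, q, hq, hqS, hpq⟩ := hB.2 (S ∩ B) Set.inter_subset_right hSB
        (fun he => hBS (he ▸ Set.inter_subset_left))
      exact ⟨p, hp.1, q, .inr hq, fun h' => hqS ⟨h', hq⟩, hpq⟩
    · obtain ⟨s, hs⟩ := hne
      have hwS : w ∉ S := fun h' => hSB ⟨w, h', hw⟩
      obtain rfl : s = u := (hS hs).resolve_right fun h' => hSB ⟨s, hs, h'⟩
      exact ⟨s, hs, w, .inr hw, hwS, h⟩

theorem setConnected_singleton {V : Type*} (G : SimpleGraph V) (u : V) : SetConnected G {u} :=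
  ⟨⟨u, rfl⟩, fun _ hS hne hS' => (hS' (hne.subset_singleton_iff.1 hS)).elim⟩

/-- A vertex `u` that disconnects `B` cuts off a part of `B` that avoids a given vertex `r`. -/
theorem exists_part_of_not_setConnected {V : Type*} {G : SimpleGraph V} {B : Set V} {u r : V}
    (hr : r ∈ B) (hru : r ≠ u) (hconn : ¬ SetConnected G {p | p ∈ B ∧ p ≠ u}) :
    ∃ K ⊆ B, u ∉ K ∧ K.Nonempty ∧ r ∉ K ∧ ∀ p ∈ K, ∀ q ∈ B, q ∉ K → q ≠ u → ¬ G.Adj p q := by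
  unfold SetConnected at hconn
  push Not at hconn
  obtain ⟨S, hS, hSne, hSB, hSc⟩ := hconn ⟨r, hr, hru⟩
  by_cases hrS : r ∈ S
  · obtain ⟨t, ht, htS⟩ := Set.exists_of_ssubset (hS.ssubset_of_ne hSB)
    refine ⟨{p | p ∈ B ∧ p ≠ u} \ S, fun p hp => hp.1.1, fun h => h.1.2 rfl, ⟨t, ht, htS⟩,
      fun h => h.2 hrS, fun p hp q hq hqK hqu hpq => ?_⟩
    have hqS : q ∈ S := by
      by_contra hqS
      exact hqK ⟨⟨hq, hqu⟩, hqS⟩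
    exact hSc q hqS p hp.1 hp.2 hpq.symm
  · exact ⟨S, fun p hp => (hS hp).1, fun h => (hS h).2 rfl, hSne, hrS,
      fun p hp q hq hqS hqu => hSc p hp q ⟨hq, hqu⟩ hqS⟩

/-- If no part of `B` is cut off from `T` by a single vertex of `B`, then every part `D` that is
attached to the rest of `B` at a single vertex `r` has a vertex that is adjacent to `T` and is not
a cut vertex of `B`. -/
theorem SetConnected.exists_noncut {V : Type*} [Finite V] {G : SimpleGraph V} {B T : Set V}
    (hB : SetConnected G B)
    (hT : ∀ c ∈ B, ∀ K ⊆ B, c ∉ K → K.Nonempty →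
      (∀ p ∈ K, ∀ q ∈ B, q ∉ K → q ≠ c → ¬ G.Adj p q) → ∃ u ∈ K, ∃ w ∈ T, G.Adj u w)
    {r : V} (hr : r ∈ B) {D : Set V} (hD : D ⊆ B) (hrD : r ∉ D) (hne : D.Nonempty)
    (hcl : ∀ p ∈ D, ∀ q ∈ B, q ∉ D → q ≠ r → ¬ G.Adj p q) :
    ∃ u ∈ D, (∃ w ∈ T, G.Adj u w) ∧ SetConnected G {p | p ∈ B ∧ p ≠ u} := by
  induction hn : D.ncard using Nat.strong_induction_on generalizing r D with
  | _ n ih =>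
    obtain ⟨u, huD, w, hw, huw⟩ := hT r hr D hD hrD hne hcl
    have hru : r ≠ u := fun h => hrD (h ▸ huD)
    by_cases hconn : SetConnected G {p | p ∈ B ∧ p ≠ u}
    · exact ⟨u, huD, ⟨w, hw, huw⟩, hconn⟩
    obtain ⟨K, hKB, hKu, hKne, hrK, hK⟩ := exists_part_of_not_setConnected hr hru hconn
    -- An edge of `B` leaving `K \ D` would either enter `D` away from `r`, against `hcl`, or leave
    -- `K` away from `u`, against `hK`. So `K` is a smaller part, attached only at `u`, and the
    -- induction continues with `u` in the role of `r`.
    have hKD : K ⊆ D := by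
      by_contra hKD
      obtain ⟨t, ht, htD⟩ := Set.not_subset.1 hKD
      obtain ⟨p, hp, q, hq, hqS, hpq⟩ := hB.2 (K \ D) (fun p hp => hKB hp.1) ⟨t, ht, htD⟩
        (fun he => hrK (he.symm.subset hr).1)
      have hpr : p ≠ r := fun h => hrK (h ▸ hp.1)
      by_cases hqD : q ∈ D
      · exact hcl q hqD p (hKB hp.1) hp.2 hpr hpq.symm
      · exact hK p hp.1 q hq (fun h => hqS ⟨h, hqD⟩) (fun h => hqD (h ▸ huD)) hpq
    refine (ih K.ncard ?_ (hD huD) hKB hKu hKne hK rfl).imp fun t ht => ⟨hKD ht.1, ht.2⟩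
    rw [← hn]
    exact Set.ncard_lt_ncard (hKD.ssubset_of_ne fun h => hKu (h ▸ huD))

/-- Fewer than `k` vertices do not separate a `k`-connected graph. -/
theorem IsKConnected.exists_adj {V : Type*} {k : ℕ} {G : SimpleGraph V} (hG : IsKConnected k G)
    {S K : Set V} (hS : S.encard < k) (hK : K.Nonempty) (hKS : ∀ p ∈ K, p ∉ S)
    (ho : ∃ q, q ∉ S ∧ q ∉ K) : ∃ p ∈ K, ∃ q, q ∉ S ∧ q ∉ K ∧ G.Adj p q := by
  obtain ⟨t, htS, htK⟩ := ho
  obtain ⟨p, hp, q, hq, hqK, h⟩ := (induce_connected_iff.1 (hG.2 S hS)).2 K hKS hK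
    (fun he => htK (he.symm.subset htS))
  exact ⟨p, hp, q, hq, hqK, h⟩

/-! ### Models, single relabellings and reconfigurability. -/

/-- The `K₄`-models of `G`. -/
abbrev IsK4Model {V : Type*} (G : SimpleGraph V) (f : V → Fin 4) : Prop :=
  IsModel (SimpleGraph.completeGraph (Fin 4)) G f

section Models

variable {V : Type*} {G : SimpleGraph V} {f g h : V → Fin 4}

theorem isK4Model_iff : IsK4Model G f ↔ (∀ i, SetConnected G {p | f p = i}) ∧
    ∀ i j, i ≠ j → ∃ p q, f p = i ∧ f q = j ∧ G.Adj p q :=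
  ⟨fun h => ⟨fun i => induce_connected_iff.1 (h.1 i), fun i j hij => h.2 i j hij⟩,
    fun h => ⟨fun i => induce_connected_iff.2 (h.1 i), fun i j hij => h.2 i j hij⟩⟩

theorem IsModel.setConnected (hf : IsK4Model G f) (i : Fin 4) : SetConnected G {p | f p = i} :=
  (isK4Model_iff.1 hf).1 i

theorem IsModel.exists_adj (hf : IsK4Model G f) {i j : Fin 4} (hij : i ≠ j) :
    ∃ p q, f p = i ∧ f q = j ∧ G.Adj p q :=
  (isK4Model_iff.1 hf).2 i j hij

/-- Relabelling `u` by `j` keeps a model if `u` has a neighbour labelled `j` and the branch set that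
`u` leaves stays connected and adjacent to the two remaining branch sets. -/
theorem IsModel.relabel [DecidableEq V] (hf : IsK4Model G f) {u : V} {j : Fin 4} (hj : j ≠ f u)
    (hw : ∃ w, f w = j ∧ G.Adj u w) (hc : SetConnected G {p | f p = f u ∧ p ≠ u})
    (hl : ∀ l, l ≠ f u → l ≠ j → ∃ p q, f p = f u ∧ p ≠ u ∧ f q = l ∧ G.Adj p q) :
    IsK4Model G (update f u j) := by
  have key : ∀ p, p ≠ u → update f u j p = f p := fun p hp => update_of_ne hp _ _
  have keyu : update f u j u = j := update_self _ _ _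
  refine isK4Model_iff.2 ⟨fun i => ?_, ?_⟩
  · by_cases hi : i = f u
    · convert hc using 1
      ext p
      by_cases hp : p = u
      · subst hp
        simp [hi, hj]
      · simp [hi, hp]
    by_cases hij : i = j
    · obtain ⟨w, hwj, huw⟩ := hw
      convert (hf.setConnected j).insert hwj huw using 1
      ext p
      by_cases hp : p = u
      · subst hp
        simp [hij]
      · simp [hij, hp]
    · convert hf.setConnected i using 1
      ext p
      by_cases hp : p = u
      · subst hp
        simp [Ne.symm hij, Ne.symm hi]
      · simp [key p hp]
  have main : ∀ l, l ≠ f u → ∃ p q, update f u j p = f u ∧ update f u j q = l ∧ G.Adj p q := by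
    intro l hlu
    by_cases hlj : l = j
    · obtain ⟨t, ht, htu⟩ := hc.1
      obtain ⟨p, rfl, q, hq, hqu, hpq⟩ := (hf.setConnected (f u)).2 {u} (by simp) ⟨u, rfl⟩
        (fun he => htu (he.symm.subset ht))
      exact ⟨q, p, by rw [key q hqu]; exact hq, by rw [keyu, hlj], hpq.symm⟩
    · obtain ⟨p, q, hp, hpu, hq, hpq⟩ := hl l hlu hlj
      exact ⟨p, q, by rw [key p hpu, hp], by rw [key q (fun h => hlu (by rw [← hq, h])), hq], hpq⟩
  intro i i' hii
  by_cases hi : i = f u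
  · subst hi
    exact main i' hii.symm
  by_cases hi' : i' = f u
  · subst hi'
    obtain ⟨p, q, hp, hq, hpq⟩ := main i hi
    exact ⟨q, p, hq, hp, hpq.symm⟩
  obtain ⟨p, q, hp, hq, hpq⟩ := hf.exists_adj hii
  exact ⟨p, q, by rw [key p (fun h => hi (by rw [← hp, h])), hp],
    by rw [key q (fun h => hi' (by rw [← hq, h])), hq], hpq⟩

/-- `f` and `g` are models in the same component of the reconfiguration graph. -/
def Reconfigurable (G : SimpleGraph V) (f g : V → Fin 4) : Prop :=
  ∃ (hf : IsK4Model G f) (hg : IsK4Model G g),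
    (reconfigurationGraph (SimpleGraph.completeGraph (Fin 4)) G).Reachable ⟨f, hf⟩ ⟨g, hg⟩

theorem IsModel.reconfigurable (hf : IsK4Model G f) : Reconfigurable G f f := ⟨hf, hf, .rfl⟩

theorem Reconfigurable.trans (h₁ : Reconfigurable G f g) (h₂ : Reconfigurable G g h) :
    Reconfigurable G f h := by
  obtain ⟨hf, hg, h₁⟩ := h₁
  obtain ⟨_, hh, h₂⟩ := h₂
  exact ⟨hf, hh, h₁.trans h₂⟩

theorem Reconfigurable.symm (h₁ : Reconfigurable G f g) : Reconfigurable G g f := by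
  obtain ⟨hf, hg, h₁⟩ := h₁
  exact ⟨hg, hf, h₁.symm⟩

theorem Reconfigurable.right (h₁ : Reconfigurable G f g) : IsK4Model G g := h₁.2.1

theorem reconfigurable_of_eqOn (hf : IsK4Model G f) (hg : IsK4Model G g) {u : V}
    (h : ∀ p, p ≠ u → f p = g p) : Reconfigurable G f g := by
  by_cases hu : f u = g u
  · obtain rfl : f = g := funext fun p => by
      by_cases hp : p = u
      · rw [hp, hu]
      · exact h p hp
    exact hf.reconfigurable
  · refine ⟨hf, hg, SimpleGraph.Adj.reachable ⟨u, hu, fun p hp => ?_⟩⟩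
    by_contra hpu
    exact hp (h p hpu)

theorem reconfigurable_update [DecidableEq V] (hf : IsK4Model G f) {u : V} {j : Fin 4}
    (hg : IsK4Model G (Function.update f u j)) : Reconfigurable G f (Function.update f u j) :=
  reconfigurable_of_eqOn hf hg fun _ hp => (update_of_ne hp _ _).symm

end Models

/-! ### Giving two adjacent vertices a common label. -/

theorem encard_triple_lt {V : Type*} (a b c : V) : ({a, b, c} : Set V).encard < (4 : ℕ) := by
  classical
  have h : (({a, b, c} : Finset V).card : ℕ∞) < (4 : ℕ) :=
    Nat.cast_lt.2 (Finset.card_le_three.trans_lt (by norm_num))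
  rw [← Set.encard_coe_eq_coe_finsetCard] at h
  simpa using h

section Merge

variable {V : Type*} {G : SimpleGraph V} {x y : V} {f : V → Fin 4}

open Classical in
/-- If `x` is alone in its branch set and has a neighbour `u` that can be relabelled like `x` and is
adjacent to the remaining two branch sets, then moving `u` to `x` and `x` to `y` is possible. -/
theorem IsModel.merge_of_neighbor (hf : IsK4Model G f) (hxy : G.Adj x y) (hne : f x ≠ f y)
    (hx : ∀ p, f p = f x → p = x) {u w : V} (hxu : G.Adj x u) (hux : f u ≠ f x) (huy : f u ≠ f y)
    (hwx : f w ≠ f x) (hwy : f w ≠ f y) (hwu : f w ≠ f u) (huw : G.Adj u w)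
    (hc : SetConnected G {p | f p = f u ∧ p ≠ u})
    (hcy : ∃ p, f p = f u ∧ p ≠ u ∧ G.Adj p y)
    (hcw : ∃ p q, f p = f u ∧ p ≠ u ∧ f q = f w ∧ G.Adj p q) :
    ∃ g, Reconfigurable G f g ∧ g x = g y := by
  have only : ∀ m, m ≠ f x → m ≠ f y → m = f u ∨ m = f w := by
    intro m h1 h2
    omega
  have hux' : u ≠ x := fun h => hux (h ▸ rfl)
  have hf1 : IsK4Model G (Function.update f u (f x)) := by
    refine hf.relabel hux.symm ⟨x, rfl, hxu.symm⟩ hc fun l hlu hlx => ?_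
    by_cases hly : l = f y
    · obtain ⟨p, hp, hpu, hpy⟩ := hcy
      exact ⟨p, y, hp, hpu, hly.symm, hpy⟩
    · obtain rfl := (only l hlx hly).resolve_left hlu
      exact hcw
  set f1 := Function.update f u (f x) with hf1_def
  have hk : ∀ p, p ≠ u → f1 p = f p := fun p hp => update_of_ne hp _ _
  have hfu : f1 u = f x := update_self _ _ _
  have hfx : f1 x = f x := hk x hux'.symm
  have hfy : f1 y = f y := hk y fun h => huy (h ▸ rfl)
  have hset : {p | f1 p = f1 x ∧ p ≠ x} = {u} := by
    ext p
    rw [hfx]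
    constructor
    · rintro ⟨h1, h2⟩
      by_contra hpu
      exact h2 (hx p (hk p hpu ▸ h1))
    · rintro rfl
      exact ⟨hfu, hux'⟩
  have hf2 : IsK4Model G (Function.update f1 x (f y)) := by
    refine hf1.relabel (by rw [hfx]; exact hne.symm) ⟨y, hfy, hxy⟩
      (by rw [hset]; exact setConnected_singleton G u) fun l hlx hly => ?_
    rw [hfx] at hlx ⊢
    rcases only l hlx hly with rfl | rfl
    · obtain ⟨t, ht, htu⟩ := hc.1
      obtain ⟨p, rfl, q, hq, hqu, hpq⟩ := (hf.setConnected (f u)).2 {u} (by simp) ⟨u, rfl⟩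
        (fun he => htu (he.symm.subset ht))
      exact ⟨p, q, hfu, hux', by rw [hk q hqu]; exact hq, hpq⟩
    · exact ⟨u, w, hfu, hux', hk w huw.ne', huw⟩
  refine ⟨_, (reconfigurable_update hf hf1).trans (reconfigurable_update hf1 hf2), ?_⟩
  rw [update_self, update_of_ne hxy.ne', hfy]

variable [Finite V]

open Classical in
/-- If the branch set of `x` has further vertices, then either `x` itself can be relabelled like its
neighbour `y` or one of these vertices can be relabelled by a label in `J`. -/
theorem IsModel.exists_relabel (hf : IsK4Model G f) (hxy : G.Adj x y) (hne : f x ≠ f y)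
    {J : Set (Fin 4)} (hJ : ∀ l, l ≠ f x → l ≠ f y → l ∈ J) (hJx : f x ∉ J)
    (hx : ∃ p, f p = f x ∧ p ≠ x)
    (hT : ∀ c ∈ {p | f p = f x}, ∀ K ⊆ {p | f p = f x}, c ∉ K → K.Nonempty →
      (∀ p ∈ K, ∀ q ∈ {p | f p = f x}, q ∉ K → q ≠ c → ¬ G.Adj p q) →
      ∃ u ∈ K, ∃ w ∈ {w | f w ∈ J}, G.Adj u w) :
    (∃ g, Reconfigurable G f g ∧ g x = g y) ∨
      ∃ u j, f u = f x ∧ u ≠ x ∧ j ∈ J ∧ IsK4Model G (Function.update f u j) := by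
  by_contra! hcon
  obtain ⟨hwin, hno⟩ := hcon
  have hB := hf.setConnected (f x)
  -- A non-cut vertex `u ≠ x` with a neighbour labelled in `J` can fail to move only by being the
  -- sole contact with some third label; contact with the label of `y` survives through the edge
  -- `xy`.
  have blocked : ∀ u, f u = f x → u ≠ x → SetConnected G {p | p ∈ {p | f p = f x} ∧ p ≠ u} →
      ∀ w, f w ∈ J → G.Adj u w → ∃ l, l ≠ f x ∧ l ≠ f w ∧ l ≠ f y ∧
        ∀ p q, f p = f x → p ≠ u → f q = l → ¬ G.Adj p q := by
    intro u hu hux hc w hw huw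
    by_contra! hall
    refine hno u (f w) hu hux hw
      (hf.relabel (fun h => hJx (by rw [← hu, ← h]; exact hw)) ⟨w, rfl, huw⟩
        (by rw [hu]; exact hc) fun l hl hlw => ?_)
    rw [hu] at hl ⊢
    by_cases hly : l = f y
    · exact ⟨x, y, rfl, hux.symm, hly.symm, hxy⟩
    · exact hall l hl hlw hly
  obtain ⟨u, ⟨hu, hux⟩, ⟨w, hw, huw⟩, hcu⟩ := hB.exists_noncut hT (r := x) rfl
    (D := {p | f p = f x ∧ p ≠ x}) (fun p hp => hp.1) (fun h => h.2 rfl) hx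
    fun p _ q hq hqD hqx => absurd ⟨hq, hqx⟩ hqD
  obtain ⟨l, hlx, -, hly, hl⟩ := blocked u hu hux hcu w hw huw
  obtain ⟨p, q, hp, hq, hpq⟩ := hf.exists_adj hlx.symm
  obtain rfl : p = u := by
    by_contra hpu
    exact hl p q hp hpu hq hpq
  -- Moving the same vertex to the label `l` is blocked as well, now by the other third label. So it
  -- alone carries the contacts with both, and `x` can leave unless `x` is a cut vertex.
  obtain ⟨l', hlx', hll, hly', hl'⟩ := blocked p hu hux hcu q (hq ▸ hJ l hlx hly) hpq
  rw [hq] at hll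
  have only : ∀ m, m ≠ f x → m ≠ f y → m = l ∨ m = l' := by
    intro m h1 h2
    omega
  have contact : ∀ m, m ≠ f x → m ≠ f y → ∃ w, f w = m ∧ G.Adj p w := by
    intro m h1 h2
    obtain ⟨s, t, hs, ht, hst⟩ := hf.exists_adj h1.symm
    obtain rfl : s = p := by
      by_contra hsp
      rcases only m h1 h2 with rfl | rfl
      · exact hl s t hs hsp ht hst
      · exact hl' s t hs hsp ht hst
    exact ⟨t, ht, hst⟩
  by_cases hcx : SetConnected G {p | p ∈ {p | f p = f x} ∧ p ≠ x}
  · refine hwin _ (reconfigurable_update hf (u := x) (j := f y)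
      (hf.relabel hne.symm ⟨y, rfl, hxy⟩ hcx fun m h1 h2 => ?_)) ?_
    · obtain ⟨t, ht, hpt⟩ := contact m h1 h2
      exact ⟨p, t, hu, hux, ht, hpt⟩
    · rw [update_self, update_of_ne hxy.ne']
  obtain ⟨K, hKB, hxK, hKne, hpK, hK⟩ := exists_part_of_not_setConnected (B := {p | f p = f x}) hu hux hcx
  -- A non-cut vertex in the part behind `x` is blocked too, which is absurd because `p` stays
  -- behind and touches both third labels.
  obtain ⟨s, hs, ⟨t, ht, hst⟩, hcs⟩ := hB.exists_noncut hT (r := x) rfl hKB hxK hKne hK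
  obtain ⟨m, hmx, -, hmy, hm⟩ := blocked s (hKB hs) (fun h => hxK (h ▸ hs)) hcs t ht hst
  obtain ⟨w', hw', hpw⟩ := contact m hmx hmy
  exact hm p w' hu (fun h => hpK (h ▸ hs)) hw' hpw

theorem ncard_update_lt [DecidableEq V] {u : V} {i j : Fin 4} (hu : f u = i) (hj : j ≠ i) :
    {p | update f u j p = i}.ncard < {p | f p = i}.ncard := by
  refine Set.ncard_lt_ncard ⟨fun p hp => ?_, fun h => ?_⟩
  · by_cases hpu : p = u
    · subst hpu
      exact hu
    · simpa [hpu] using hp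
  · have := h hu
    simp [hj] at this


-- Each relabelling from `IsModel.exists_relabel` removes a vertex other than `x` from the branch
-- set of `x`. The required outside neighbours exist because deleting one vertex of `G` leaves it
-- connected.
open Classical in
theorem IsModel.merge_or_shrink (hG : IsKConnected 4 G) (hf : IsK4Model G f) (hxy : G.Adj x y)
    (hne : f x ≠ f y) : (∃ g, Reconfigurable G f g ∧ g x = g y) ∨
      ∃ g, Reconfigurable G f g ∧ g x ≠ g y ∧ ∀ p, g p = g x → p = x := by
  induction hn : {p | f p = f x}.ncard using Nat.strong_induction_on generalizing f with
  | _ n ih =>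
    by_cases hx : ∃ p, f p = f x ∧ p ≠ x
    swap
    · push Not at hx
      exact .inr ⟨f, hf.reconfigurable, hne, hx⟩
    rcases hf.exists_relabel hxy hne (J := {l | l ≠ f x}) (fun l hl _ => hl) (fun h => h rfl) hx
      (by
        intro c hc K hK hcK hKne hcl
        have hyB : f y ≠ f x := hne.symm
        obtain ⟨p, hp, q, hqS, hqK, hpq⟩ := hG.exists_adj (S := {c}) (K := K)
          (by simp) hKne (fun p hp h => hcK (h ▸ hp))
          ⟨y, fun h => hyB (by rw [h]; exact hc), fun h => hyB (hK h)⟩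
        exact ⟨p, hp, q, fun h => hcl p hp q h hqK hqS hpq, hpq⟩)
      with hwin | ⟨u, j, hu, hux, hj, hg⟩
    · exact .inl hwin
    · have hfg := reconfigurable_update hf hg
      have hgx : update f u j x = f x := update_of_ne hux.symm _ _
      have hgne : update f u j x ≠ update f u j y := by
        by_cases huy : y = u
        · subst huy
          exact absurd hu hne.symm
        · rwa [hgx, update_of_ne huy]
      rcases ih _ (by rw [← hn, hgx]; exact ncard_update_lt hu hj) hg hgne rfl with
        ⟨g, h1, h2⟩ | ⟨g, h1, h2⟩
      · exact .inl ⟨g, hfg.trans h1, h2⟩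
      · exact .inr ⟨g, hfg.trans h1, h2⟩

-- The same descent for `y`, with the label of `x` excluded from `J` so that `x` stays alone. The
-- outside neighbours must now avoid `x`, so two vertices are deleted.
open Classical in
theorem IsModel.merge_or_shrink_right (hG : IsKConnected 4 G) (hf : IsK4Model G f)
    (hxy : G.Adj x y) (hne : f x ≠ f y) (hx : ∀ p, f p = f x → p = x) :
    (∃ g, Reconfigurable G f g ∧ g x = g y) ∨ ∃ g, Reconfigurable G f g ∧ g x ≠ g y ∧
      (∀ p, g p = g x → p = x) ∧ ∀ p, g p = g y → p = y := by
  induction hn : {p | f p = f y}.ncard using Nat.strong_induction_on generalizing f with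
  | _ n ih =>
    by_cases hy : ∃ p, f p = f y ∧ p ≠ y
    swap
    · push Not at hy
      exact .inr ⟨f, hf.reconfigurable, hne, hx, hy⟩
    rcases hf.exists_relabel hxy.symm hne.symm (J := {l | l ≠ f y ∧ l ≠ f x})
      (fun l hl hl' => ⟨hl, hl'⟩) (fun h => h.1 rfl) hy
      (by
        intro c hc K hK hcK hKne hcl
        obtain ⟨l, hlx, hly⟩ : ∃ l : Fin 4, l ≠ f x ∧ l ≠ f y := by
          generalize f x = a
          generalize f y = b
          decide +revert
        obtain ⟨t, rfl⟩ := (hf.setConnected l).1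
        -- The repeated `x` only serves to reuse the bound for triples.
        have hKS : ∀ p ∈ K, p ∉ ({c, x, x} : Set V) := by
          rintro p hp (rfl | rfl | rfl)
          · exact hcK hp
          · exact hne (hK hp)
          · exact hne (hK hp)
        have htS : t ∉ ({c, x, x} : Set V) := by
          rintro (rfl | rfl | rfl)
          · exact hly hc
          · exact hlx rfl
          · exact hlx rfl
        obtain ⟨p, hp, q, hqS, hqK, hpq⟩ := hG.exists_adj (encard_triple_lt _ _ _) hKne hKS
          ⟨t, htS, fun h => hly (hK h)⟩
        simp only [Set.mem_insert_iff, Set.mem_singleton_iff, not_or] at hqS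
        exact ⟨p, hp, q, ⟨fun h => hcl p hp q h hqK hqS.1 hpq, fun h => hqS.2.1 (hx q h)⟩, hpq⟩)
      with ⟨g, h1, h2⟩ | ⟨u, j, hu, huy, hj, hg⟩
    · exact .inl ⟨g, h1, h2.symm⟩
    · have hfg := reconfigurable_update hf hg
      have hux : u ≠ x := by
        rintro rfl
        exact hne hu
      have hgx : update f u j x = f x := update_of_ne hux.symm _ _
      have hgy : update f u j y = f y := update_of_ne huy.symm _ _
      have hgx1 : ∀ p, update f u j p = update f u j x → p = x := by
        intro p hp
        rw [hgx] at hp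
        by_cases hpu : p = u
        · subst hpu
          rw [update_self] at hp
          exact absurd hp hj.2
        · rw [update_of_ne hpu] at hp
          exact hx p hp
      rcases ih _ (by rw [← hn, hgy]; exact ncard_update_lt hu hj.1) hg (by rwa [hgx, hgy]) hgx1 rfl
        with ⟨g, h1, h2⟩ | ⟨g, h1, h2⟩
      · exact .inl ⟨g, hfg.trans h1, h2⟩
      · exact .inr ⟨g, hfg.trans h1, h2⟩

-- Descent on the branch set of `s`: pick a vertex `u` in it that can leave without destroying any
-- contact. If `u` is adjacent to `x` or `y`, it makes a merge possible; otherwise it moves to the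
-- fourth label, leaving `s` and `t` in place.
open Classical in
theorem IsModel.merge_of_two_neighbors (hG : IsKConnected 4 G) (hf : IsK4Model G f)
    (hxy : G.Adj x y) (hne : f x ≠ f y) (hx : ∀ p, f p = f x → p = x)
    (hy : ∀ p, f p = f y → p = y) {s t : V} (hst : s ≠ t) (hs : G.Adj x s) (ht : G.Adj x t)
    (hfst : f s = f t) (hsx : f s ≠ f x) (hsy : f s ≠ f y) :
    ∃ g, Reconfigurable G f g ∧ g x = g y := by
  induction hn : {p | f p = f s}.ncard using Nat.strong_induction_on generalizing f with
  | _ n ih =>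
    obtain ⟨d, hdx, hdy, hds⟩ : ∃ l : Fin 4, l ≠ f x ∧ l ≠ f y ∧ l ≠ f s := by
      generalize f x = a
      generalize f y = b
      generalize f s = c
      decide +revert
    have only : ∀ m, m ≠ f x → m ≠ f y → m = f s ∨ m = d := by
      intro m h1 h2
      omega
    obtain ⟨y', r, hy', hr, hyr⟩ := hf.exists_adj hsy.symm
    obtain rfl := hy y' hy'
    obtain ⟨z, rfl⟩ := (hf.setConnected d).1
    -- Here 4-connectivity is used in full: after deleting `c` and the singleton branch sets of `x`
    -- and `y`, the only way out of `K` leads to the fourth label.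
    have hT : ∀ c ∈ {p | f p = f s}, ∀ K ⊆ {p | f p = f s}, c ∉ K → K.Nonempty →
        (∀ p ∈ K, ∀ q ∈ {p | f p = f s}, q ∉ K → q ≠ c → ¬ G.Adj p q) →
        ∃ u ∈ K, ∃ w ∈ {w | f w = f z}, G.Adj u w := by
      intro c hc K hK hcK hKne hcl
      have hKS : ∀ p ∈ K, p ∉ ({c, x, y'} : Set V) := by
        rintro p hp (rfl | rfl | rfl)
        · exact hcK hp
        · exact hsx (hK hp).symm
        · exact hsy (hK hp).symm
      have hzS : z ∉ ({c, x, y'} : Set V) := by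
        rintro (rfl | rfl | rfl)
        · exact hds hc
        · exact hdx rfl
        · exact hdy rfl
      obtain ⟨p, hp, q, hqS, hqK, hpq⟩ := hG.exists_adj (encard_triple_lt _ _ _) hKne hKS
        ⟨z, hzS, fun h => hds (hK h)⟩
      simp only [Set.mem_insert_iff, Set.mem_singleton_iff, not_or] at hqS
      have hqs : f q ≠ f s := fun h => hcl p hp q h hqK hqS.1 hpq
      exact ⟨p, hp, q, (only _ (fun h => hqS.2.1 (hx q h))
        (fun h => hqS.2.2 (hy q h))).resolve_left hqs, hpq⟩
    obtain ⟨u, ⟨hu, hur⟩, ⟨w, hw, huw⟩, hcu⟩ := (hf.setConnected (f s)).exists_noncut hT hr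
      (D := {p | f p = f s ∧ p ≠ r}) (fun p hp => hp.1) (fun h => h.2 rfl)
      (by
        by_cases hsr : s = r
        · exact ⟨t, hfst.symm, fun h => hst (hsr.trans h.symm)⟩
        · exact ⟨s, rfl, hsr⟩)
      fun p _ q hq hqD hqr => absurd ⟨hq, hqr⟩ hqD
    -- Without `u` the branch set still touches `x` through `v` (one of `s`, `t`), `y` through `r`,
    -- and the fourth label through the edge `pq` found next.
    obtain ⟨v, hv, hvu, hxv⟩ : ∃ v, f v = f s ∧ v ≠ u ∧ G.Adj v x := by
      by_cases hsu : s = u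
      · exact ⟨t, hfst.symm, fun h => hst (hsu.trans h.symm), ht.symm⟩
      · exact ⟨s, rfl, hsu, hs.symm⟩
    obtain ⟨p, ⟨hp, hpu⟩, q, hq, hpq⟩ := hT u hu {p | f p = f s ∧ p ≠ u} (fun p hp => hp.1)
      (fun h => h.2 rfl) ⟨r, hr, hur.symm⟩ fun p _ q hq hqD hqr => absurd ⟨hq, hqr⟩ hqD
    have hw' : f w = f z := hw
    by_cases hxu : G.Adj x u
    · exact hf.merge_of_neighbor hxy hne hx hxu (w := w) (by rwa [hu]) (by rwa [hu]) (by rwa [hw'])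
        (by rwa [hw']) (by rwa [hw', hu]) huw (by rw [hu]; exact hcu)
        ⟨r, by rw [hr, hu], hur.symm, hyr.symm⟩ ⟨p, q, by rw [hp, hu], hpu, by rw [hw']; exact hq, hpq⟩
    by_cases hyu : G.Adj y' u
    · obtain ⟨g, h1, h2⟩ := hf.merge_of_neighbor hxy.symm hne.symm hy hyu (w := w) (by rwa [hu])
        (by rwa [hu]) (by rwa [hw']) (by rwa [hw']) (by rwa [hw', hu]) huw (by rw [hu]; exact hcu)
        ⟨v, by rw [hv, hu], hvu, hxv⟩ ⟨p, q, by rw [hp, hu], hpu, by rw [hw']; exact hq, hpq⟩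
      exact ⟨g, h1, h2.symm⟩
    have hg : IsK4Model G (Function.update f u (f z)) := by
      refine hf.relabel (by rwa [hu]) ⟨w, hw, huw⟩ (by rw [hu]; exact hcu) fun l hls hlz => ?_
      rw [hu] at hls ⊢
      by_cases hlx : l = f x
      · exact ⟨v, x, hv, hvu, hlx.symm, hxv⟩
      by_cases hly : l = f y'
      · exact ⟨r, y', hr, hur.symm, hly.symm, hyr.symm⟩
      · exact ((only l hlx hly).elim hls hlz).elim
    have hk : ∀ p, p ≠ u → Function.update f u (f z) p = f p := fun p hp => update_of_ne hp _ _
    have hgx := hk x fun h => hsx (by rw [h, hu])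
    have hgy := hk y' fun h => hsy (by rw [h, hu])
    have hgs := hk s fun h => hxu (h ▸ hs)
    have hgt := hk t fun h => hxu (h ▸ ht)
    have single : ∀ a, f a ≠ f z → (∀ p, f p = f a → p = a) →
        ∀ p, Function.update f u (f z) p = f a → p = a := by
      intro a haz ha p hp
      by_cases hpu : p = u
      · subst hpu
        rw [update_self] at hp
        exact absurd hp.symm haz
      · exact ha p (hk p hpu ▸ hp)
    obtain ⟨g, h1, h2⟩ := ih _ (by rw [← hn, hgs]; exact ncard_update_lt hu hds) hg
      (by rwa [hgx, hgy]) (by rw [hgx]; exact single x hdx.symm hx)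
      (by rw [hgy]; exact single y' hdy.symm hy) (by rwa [hgs, hgt]) (by rwa [hgs, hgx])
      (by rwa [hgs, hgy]) rfl
    exact ⟨g, (reconfigurable_update hf hg).trans h1, h2⟩

/-- In a `4`-connected graph every `K₄`-model can be reconfigured so that two given adjacent vertices
get the same label. -/
theorem IsModel.merge (hG : IsKConnected 4 G) (hf : IsK4Model G f) (hxy : G.Adj x y) :
    ∃ g, Reconfigurable G f g ∧ g x = g y := by
  by_cases hne : f x = f y
  · exact ⟨f, hf.reconfigurable, hne⟩
  obtain h | ⟨f₁, h₁, hne₁, hx₁⟩ := hf.merge_or_shrink hG hxy hne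
  · exact h
  obtain ⟨g, h₂, h⟩ | ⟨f₂, h₂, hne₂, hx₂, hy₂⟩ := h₁.right.merge_or_shrink_right hG hxy hne₁ hx₁
  · exact ⟨g, h₁.trans h₂, h⟩
  have hf₂ := h₂.right
  suffices ∃ s t, s ≠ t ∧ G.Adj x s ∧ G.Adj x t ∧ f₂ s = f₂ t ∧ f₂ s ≠ f₂ x ∧ f₂ s ≠ f₂ y by
    obtain ⟨s, t, hst, hs, ht, h3, h4, h5⟩ := this
    obtain ⟨g, h₃, h⟩ := hf₂.merge_of_two_neighbors hG hxy hne₂ hx₂ hy₂ hst hs ht h3 h4 h5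
    exact ⟨g, h₁.trans (h₂.trans h₃), h⟩
  obtain ⟨c, d, hcx, hcy, hdx, hdy, hcd⟩ : ∃ c d : Fin 4, c ≠ f₂ x ∧ c ≠ f₂ y ∧ d ≠ f₂ x ∧
      d ≠ f₂ y ∧ ∀ m, m ≠ f₂ x → m ≠ f₂ y → m = c ∨ m = d := by
    generalize f₂ x = a at *
    generalize f₂ y = b at *
    clear * - hne₂
    decide +revert
  obtain ⟨x', s, hx', rfl, hxs⟩ := hf₂.exists_adj hcx.symm
  obtain rfl := hx₂ x' hx'
  obtain ⟨x', t, hx', rfl, hxt⟩ := hf₂.exists_adj hdx.symm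
  obtain rfl := hx₂ x' hx'
  -- A vertex outside these four shows that `{y, s, t}` does not contain all other vertices, so `x'`
  -- has a further neighbour `q`, which repeats the label of `s` or `t`.
  obtain ⟨z, hz⟩ : ∃ z, z ∉ ({x', y, s, t} : Set V) := by
    by_contra! hall
    have h4 := hG.1
    rw [← Set.encard_univ, ← Set.eq_univ_of_forall hall] at h4
    classical
    have h5 : (({x', y, s, t} : Finset V).card : ℕ∞) ≤ (4 : ℕ) := Nat.cast_le.2 Finset.card_le_four
    rw [← Set.encard_coe_eq_coe_finsetCard] at h5
    exact absurd h4 (not_lt.2 (by simpa using h5))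
  simp only [Set.mem_insert_iff, Set.mem_singleton_iff, not_or] at hz
  obtain ⟨p, rfl, q, hqS, hqx, hpq⟩ := hG.exists_adj (S := {y, s, t}) (K := {x'})
    (encard_triple_lt _ _ _) ⟨x', rfl⟩
    (by
      rintro p rfl (h | h | h)
      · exact hxy.ne h
      · exact hxs.ne h
      · exact hxt.ne h)
    ⟨z, by simp [hz], by simp [hz]⟩
  simp only [Set.mem_insert_iff, Set.mem_singleton_iff, not_or] at hqS
  have h1 : f₂ q ≠ f₂ p := fun h => hqx (hx₂ q h)
  have h2 : f₂ q ≠ f₂ y := fun h => hqS.1 (hy₂ q h)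
  rcases hcd _ h1 h2 with h | h
  · exact ⟨q, s, hqS.2.1, hpq, hxs, h, h1, h2⟩
  · exact ⟨q, t, hqS.2.2, hpq, hxt, h, h1, h2⟩

end Merge

/-! ### Moving two adjacent vertices together. -/

section Lift

variable {V : Type*} {G : SimpleGraph V} {x y : V} {f f' : V → Fin 4}

/-- The remainder is precisely the branch set of that label in `f'`. -/
theorem IsModel.setConnected_diff_pair (hf' : IsK4Model G f') (hfxy : f x = f y)
    (hfx' : f' x ≠ f x) (hfy' : f' y ≠ f y) (hoff : ∀ p, p ≠ x → p ≠ y → f p = f' p) :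
    SetConnected G {p | f p = f x ∧ p ≠ x ∧ p ≠ y} := by
  convert hf'.setConnected (f x) using 1
  ext p
  constructor
  · rintro ⟨h, h1, h2⟩
    exact (hoff p h1 h2).symm.trans h
  · intro h
    have h1 : p ≠ x := by
      rintro rfl
      exact hfx' h
    have h2 : p ≠ y := by
      rintro rfl
      exact hfy' (h.trans hfxy)
    exact ⟨(hoff p h1 h2).trans h, h1, h2⟩

theorem IsModel.exists_adj_diff_pair (hf' : IsK4Model G f') (hfxy : f x = f y)
    (hfx' : f' x ≠ f x) (hfxy' : f' x = f' y) (hoff : ∀ p, p ≠ x → p ≠ y → f p = f' p)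
    {l : Fin 4} (hl : l ≠ f x) (hl' : l ≠ f' x) :
    ∃ p q, (f p = f x ∧ p ≠ x ∧ p ≠ y) ∧ f q = l ∧ G.Adj p q := by
  obtain ⟨p, q, hp, rfl, hpq⟩ := hf'.exists_adj hl.symm
  have h1 : p ≠ x := by
    rintro rfl
    exact hfx' hp
  have h2 : p ≠ y := by
    rintro rfl
    exact hfx' (hfxy'.trans hp)
  have h3 : q ≠ x := by
    rintro rfl
    exact hl' rfl
  have h4 : q ≠ y := by
    rintro rfl
    exact hl' hfxy'.symm
  exact ⟨p, q, ⟨(hoff p h1 h2).trans hp, h1, h2⟩, hoff q h3 h4, hpq⟩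

open Classical in
/-- Moving first `x` and then `y` from one branch set to another one. -/
theorem reconfigurable_of_cross (hf : IsK4Model G f) (hf' : IsK4Model G f') (hxy : G.Adj x y)
    (hfxy : f x = f y) (hfxy' : f' x = f' y) (hfx' : f' x ≠ f x)
    (hoff : ∀ p, p ≠ x → p ≠ y → f p = f' p)
    (hys : ∃ s, (f s = f x ∧ s ≠ x ∧ s ≠ y) ∧ G.Adj y s) (hxw : ∃ w, f w = f' x ∧ G.Adj x w) :
    Reconfigurable G f f' := by
  have hS := hf'.setConnected_diff_pair hfxy hfx' (hfxy' ▸ hfxy ▸ hfx') hoff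
  have hg : IsK4Model G (Function.update f x (f' x)) := by
    refine hf.relabel hfx' hxw ?_ fun l hl hl' => ?_
    · obtain ⟨s, hs, hys⟩ := hys
      convert hS.insert hs hys using 1
      ext p
      by_cases hpy : p = y
      · subst hpy
        simp [hfxy, hxy.ne']
      · simp [hpy]
    · obtain ⟨p, q, hp, hq, hpq⟩ := hf'.exists_adj_diff_pair hfxy hfx' hfxy' hoff hl hl'
      exact ⟨p, q, hp.1, hp.2.1, hq, hpq⟩
  refine (reconfigurable_update hf hg).trans (reconfigurable_of_eqOn hg hf' (u := y) fun p hp => ?_)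
  by_cases hpx : p = x
  · rw [hpx, update_self]
  · rw [update_of_ne hpx, hoff p hpx hp]

open Classical in
/-- Moving `x` and `y` from one branch set to another one, where `y` makes a detour through a third
branch set. -/
theorem reconfigurable_of_detour (hf : IsK4Model G f) (hf' : IsK4Model G f') (hxy : G.Adj x y)
    (hfxy : f x = f y) (hfxy' : f' x = f' y) (hfx' : f' x ≠ f x)
    (hoff : ∀ p, p ≠ x → p ≠ y → f p = f' p)
    (hxs : ∃ s, (f s = f x ∧ s ≠ x ∧ s ≠ y) ∧ G.Adj x s) (hxw : ∃ w, f w = f' x ∧ G.Adj x w)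
    {z : V} (hyz : G.Adj y z) (hzx : f z ≠ f x) (hzx' : f z ≠ f' x) :
    Reconfigurable G f f' := by
  have hS := hf'.setConnected_diff_pair hfxy hfx' (hfxy' ▸ hfxy ▸ hfx') hoff
  obtain ⟨w, hw, hxw⟩ := hxw
  have hwy : w ≠ y := by
    rintro rfl
    exact hfx' (hw.symm.trans hfxy.symm)
  have hg : IsK4Model G (Function.update f y (f z)) := by
    refine hf.relabel (hfxy ▸ hzx) ⟨z, rfl, hyz⟩ ?_ fun l hl hl' => ?_
    · obtain ⟨s, hs, hxs⟩ := hxs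
      convert hS.insert hs hxs using 1
      ext p
      by_cases hpx : p = x
      · subst hpx
        simp [hfxy, hxy.ne]
      · simp [hpx, hfxy]
    · by_cases hlx : l = f' x
      · exact ⟨x, w, hfxy, hxy.ne, hw.trans hlx.symm, hxw⟩
      · obtain ⟨p, q, hp, hq, hpq⟩ := hf'.exists_adj_diff_pair hfxy hfx' hfxy' hoff
          (hfxy ▸ hl) hlx
        exact ⟨p, q, hp.1.trans hfxy, hp.2.2, hq, hpq⟩
  set g := Function.update f y (f z) with hg_def
  have hk : ∀ p, p ≠ y → g p = f p := fun p hp => update_of_ne hp _ _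
  have hgy : g y = f z := update_self _ _ _
  have hgx : g x = f x := hk x hxy.ne
  have hh : IsK4Model G (Function.update g x (f' x)) := by
    refine hg.relabel (by rwa [hgx]) ⟨w, by rw [hk w hwy, hw], hxw⟩ ?_ fun l hl hl' => ?_
    · convert hS using 1
      ext p
      by_cases hpy : p = y
      · subst hpy
        simp [hgx, hgy, hzx]
      · simp [hpy, hgx, hk p hpy]
    · rw [hgx] at hl ⊢
      obtain ⟨p, q, hp, hq, hpq⟩ := hf'.exists_adj_diff_pair hfxy hfx' hfxy' hoff hl hl'
      refine ⟨p, q, by rw [hk p hp.2.2, hp.1], hp.2.1, ?_, hpq⟩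
      rw [hk q, hq]
      rintro rfl
      exact hl (hq.symm.trans hfxy.symm)
  refine ((reconfigurable_update hf hg).trans (reconfigurable_update hg hh)).trans
    (reconfigurable_of_eqOn hh hf' (u := y) fun p hp => ?_)
  by_cases hpx : p = x
  · rw [hpx, update_self]
  · rw [update_of_ne hpx, hk p hp, hoff p hpx hp]

/-- If `y` touches the rest of the old branch set, `x` can go first. Otherwise `x` touches it, and
`y` goes first: directly if it touches the new branch set, else through a third label supplied by
its neighbour other than `x`. -/
theorem reconfigurable_of_left (hf : IsK4Model G f) (hf' : IsK4Model G f') (hxy : G.Adj x y)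
    (hy : ∃ z, z ≠ x ∧ G.Adj y z) (hfxy : f x = f y) (hfxy' : f' x = f' y) (hfx' : f' x ≠ f x)
    (hoff : ∀ p, p ≠ x → p ≠ y → f p = f' p) (hxw : ∃ w, f w = f' x ∧ G.Adj x w) :
    Reconfigurable G f f' := by
  by_cases hys : ∃ s, (f s = f x ∧ s ≠ x ∧ s ≠ y) ∧ G.Adj y s
  · exact reconfigurable_of_cross hf hf' hxy hfxy hfxy' hfx' hoff hys hxw
  have hxs : ∃ s, (f s = f x ∧ s ≠ x ∧ s ≠ y) ∧ G.Adj x s := by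
    obtain ⟨t, ht, htx, hty⟩ :=
      (hf'.setConnected_diff_pair hfxy hfx' (hfxy' ▸ hfxy ▸ hfx') hoff).1
    obtain ⟨p, hp, q, hq, hqS, hpq⟩ := (hf.setConnected (f x)).2 {x, y}
      (by
        rintro p (rfl | rfl)
        · rfl
        · exact hfxy.symm)
      ⟨x, .inl rfl⟩ (fun he => (he.symm.subset ht).elim htx hty)
    simp only [Set.mem_insert_iff, Set.mem_singleton_iff, not_or] at hqS
    rcases hp with rfl | rfl
    · exact ⟨q, ⟨hq, hqS⟩, hpq⟩
    · exact absurd ⟨q, ⟨hq, hqS⟩, hpq⟩ hys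
  by_cases hyw : ∃ w, f w = f' y ∧ G.Adj y w
  · refine reconfigurable_of_cross hf hf' hxy.symm hfxy.symm hfxy'.symm (hfxy' ▸ hfxy ▸ hfx')
      (fun p h1 h2 => hoff p h2 h1) ?_ hyw
    obtain ⟨s, ⟨h1, h2, h3⟩, h4⟩ := hxs
    exact ⟨s, ⟨h1.trans hfxy, h3, h2⟩, h4⟩
  obtain ⟨z, hzx, hyz⟩ := hy
  exact reconfigurable_of_detour hf hf' hxy hfxy hfxy' hfx' hoff hxs hxw hyz
    (fun h => hys ⟨z, ⟨h, hzx, hyz.ne'⟩, hyz⟩) fun h => hyw ⟨z, h.trans hfxy', hyz⟩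

/-- Two models that differ only in the common label of two adjacent vertices are reconfigurable into
each other. -/
theorem reconfigurable_of_eqOn_pair (hf : IsK4Model G f) (hf' : IsK4Model G f') (hxy : G.Adj x y)
    (hx : ∃ z, z ≠ y ∧ G.Adj x z) (hy : ∃ z, z ≠ x ∧ G.Adj y z) (hfxy : f x = f y)
    (hfxy' : f' x = f' y) (hoff : ∀ p, p ≠ x → p ≠ y → f p = f' p) : Reconfigurable G f f' := by
  by_cases hfx' : f' x = f x
  · refine reconfigurable_of_eqOn hf hf' (u := x) fun p hp => ?_
    by_cases hpy : p = y
    · rw [hpy, ← hfxy, ← hfxy', hfx']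
    · exact hoff p hp hpy
  have hsymm : ∀ p, p ≠ y → p ≠ x → f p = f' p := fun p h1 h2 => hoff p h2 h1
  obtain ⟨⟨t, ht, htx, hty⟩, -⟩ := hf.setConnected_diff_pair hfxy' (Ne.symm hfx')
    (fun h => hfx' (hfxy'.trans (h.symm.trans hfxy.symm))) fun p h1 h2 => (hoff p h1 h2).symm
  -- Connectivity of the new branch set makes `x` or `y` adjacent to the rest of it.
  obtain ⟨p, hp, q, hq, hqS, hpq⟩ := (hf'.setConnected (f' x)).2 {x, y}
    (by
      rintro p (rfl | rfl)
      · rfl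
      · exact hfxy'.symm)
    ⟨x, .inl rfl⟩ (fun he => (he.symm.subset ht).elim htx hty)
  simp only [Set.mem_insert_iff, Set.mem_singleton_iff, not_or] at hqS
  have hqf : f q = f' x := (hoff q hqS.1 hqS.2).trans hq
  rcases hp with rfl | rfl
  · exact reconfigurable_of_left hf hf' hxy hy hfxy hfxy' hfx' hoff ⟨q, hqf, hpq⟩
  · exact reconfigurable_of_left hf hf' hxy.symm hx hfxy.symm hfxy'.symm
      (hfxy' ▸ hfxy ▸ hfx') hsymm ⟨q, hqf.trans hfxy', hpq⟩

end Lift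

/-! ### Contractions and the lifting of walks. -/

/-- `φ` contracts pairwise adjacent vertices of `G'` and is onto the vertices and edges of `G`. -/
structure IsContraction {V V' : Type*} (G : SimpleGraph V) (G' : SimpleGraph V') (φ : V' → V) :
    Prop where
  surjective : Surjective φ
  adj_of_eq : ∀ p q, φ p = φ q → p ≠ q → G'.Adj p q
  map_adj : ∀ p q, G'.Adj p q → φ p ≠ φ q → G.Adj (φ p) (φ q)
  lift_adj : ∀ s t, G.Adj s t → ∃ p q, φ p = s ∧ φ q = t ∧ G'.Adj p q

section Contraction

variable {V V' : Type*} {G : SimpleGraph V} {G' : SimpleGraph V'} {φ : V' → V}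

theorem IsContraction.setConnected_preimage (h : IsContraction G G' φ) {B : Set V} :
    SetConnected G' (φ ⁻¹' B) ↔ SetConnected G B := by
  constructor
  · rintro ⟨⟨b, hb⟩, hB⟩
    refine ⟨⟨φ b, hb⟩, fun S hS ⟨s, hs⟩ hne => ?_⟩
    obtain ⟨s', rfl⟩ := h.surjective s
    obtain ⟨p, hp, q, hq, hqS, hpq⟩ := hB (φ ⁻¹' S) (fun p hp => hS hp) ⟨s', hs⟩
      (fun he => hne (h.surjective.preimage_injective he))
    exact ⟨φ p, hp, φ q, hq, hqS, h.map_adj p q hpq fun he => hqS (he ▸ hp : φ q ∈ S)⟩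
  · rintro ⟨⟨b, hb⟩, hB⟩
    obtain ⟨b', rfl⟩ := h.surjective b
    refine ⟨⟨b', hb⟩, fun S hS ⟨s, hs⟩ hne => ?_⟩
    -- If `S` is a union of fibres, an edge leaving its image lifts; otherwise `S` splits a fibre,
    -- and an edge inside that clique leaves `S`.
    by_cases hsat : ∀ p q, φ p = φ q → p ∈ S → q ∈ S
    · obtain ⟨p, ⟨p', hp', rfl⟩, q, hq, hqS, hpq⟩ := hB (φ '' S)
        (by
          rintro _ ⟨p, hp, rfl⟩
          exact hS hp)
        ⟨φ s, s, hs, rfl⟩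
        (fun he => hne (hS.antisymm fun p hp => by
          obtain ⟨q, hq, hqp⟩ := he.symm.subset hp
          exact hsat q p hqp hq))
      obtain ⟨p, q', hp, rfl, hpq'⟩ := h.lift_adj _ _ hpq
      exact ⟨p, hsat p' p hp.symm hp', q', hq, fun hq' => hqS ⟨q', hq', rfl⟩, hpq'⟩
    · push Not at hsat
      obtain ⟨p, q, hpq, hp, hq⟩ := hsat
      exact ⟨p, hp, q, show φ q ∈ B from hpq ▸ hS hp, hq,
        h.adj_of_eq p q hpq fun he => hq (he ▸ hp)⟩

theorem IsContraction.isK4Model_comp (h : IsContraction G G' φ) {g : V → Fin 4} :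
    IsK4Model G' (g ∘ φ) ↔ IsK4Model G g := by
  rw [isK4Model_iff, isK4Model_iff]
  refine and_congr (forall_congr' fun i => h.setConnected_preimage (B := {p | g p = i}))
    (forall_congr' fun i => forall_congr' fun j => forall_congr' fun hij => ⟨?_, ?_⟩)
  · rintro ⟨p, q, hp, hq, hpq⟩
    refine ⟨φ p, φ q, hp, hq, h.map_adj p q hpq fun he => hij ?_⟩
    rw [← hp, ← hq, comp_apply, comp_apply, he]
  · rintro ⟨s, t, hs, ht, hst⟩
    obtain ⟨p, q, rfl, rfl, hpq⟩ := h.lift_adj s t hst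
    exact ⟨p, q, hs, ht, hpq⟩

/-- A reconfiguration sequence in `G` lifts along the contraction of a single edge `xy`. -/
theorem IsContraction.reconfigurable_comp (h : IsContraction G G' φ) {x y : V'}
    (hxy : G'.Adj x y) (hφ : φ x = φ y) (hinj : ∀ p q, φ p = φ q → φ p ≠ φ x → p = q)
    (hfib : ∀ p, φ p = φ x → p = x ∨ p = y)
    (hx : ∃ z, z ≠ y ∧ G'.Adj x z) (hy : ∃ z, z ≠ x ∧ G'.Adj y z)
    {g g' : V → Fin 4} (hgg : Reconfigurable G g g') :
    Reconfigurable G' (g ∘ φ) (g' ∘ φ) := by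
  obtain ⟨hg, hg', ⟨w⟩⟩ := hgg
  generalize hm : (⟨g, hg⟩ : {f : V → Fin 4 // IsK4Model G f}) = m at w
  generalize hm' : (⟨g', hg'⟩ : {f : V → Fin 4 // IsK4Model G f}) = m' at w
  suffices Reconfigurable G' (m.1 ∘ φ) (m'.1 ∘ φ) by
    subst hm hm'
    exact this
  clear hm hm'
  induction w with
  | nil => exact (h.isK4Model_comp.2 (Subtype.property _)).reconfigurable
  | @cons a b c hab _ ih =>
    refine Reconfigurable.trans ?_ ih
    have ha := h.isK4Model_comp.2 a.2
    have hb := h.isK4Model_comp.2 b.2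
    obtain ⟨u, -, hu⟩ := hab
    obtain ⟨u, rfl⟩ := h.surjective u
    have hoff : ∀ p, φ p ≠ φ u → (a.1 ∘ φ) p = (b.1 ∘ φ) p := by
      intro p hp
      by_contra hne
      exact hp (hu _ hne)
    -- Changing the label of the contracted vertex changes `x` and `y` together; any other step
    -- changes a single vertex upstairs.
    by_cases hux : φ u = φ x
    · refine reconfigurable_of_eqOn_pair ha hb hxy hx hy (congrArg a.1 hφ) (congrArg b.1 hφ)
        fun p h1 h2 => hoff p fun he => ?_
      exact (hfib p (he.trans hux)).elim h1 h2
    · exact reconfigurable_of_eqOn ha hb (u := u) fun p hp => hoff p fun he =>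
        hp (hinj p u he (he ▸ hux))

open Classical in
theorem IsVertexSplit.exists_contraction {v : V} {x y : V'} (h : IsVertexSplit G G' v x y) :
    ∃ φ : V' → V, IsContraction G G' φ ∧ φ x = v ∧ φ y = v ∧ (∀ p, φ p = v → p = x ∨ p = y) ∧
      ∀ p q, φ p = φ q → φ p ≠ v → p = q := by
  obtain ⟨hxy, -, -, e, he, hv, hnv⟩ := h
  let φ : V' → V := fun p => if hp : p ≠ x ∧ p ≠ y then (e.symm ⟨p, hp⟩ : V) else v
  have hφx : φ x = v := dif_neg fun h => h.1 rfl
  have hφy : φ y = v := dif_neg fun h => h.2 rfl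
  have hφe : ∀ a, φ (e a) = a := fun a => by
    simp only [φ]
    rw [dif_pos (e a).2]
    simp
  have hcases : ∀ p, p = x ∨ p = y ∨ ∃ a, (e a : V') = p := by
    intro p
    by_cases h1 : p = x
    · exact .inl h1
    by_cases h2 : p = y
    · exact .inr (.inl h2)
    exact .inr (.inr ⟨e.symm ⟨p, h1, h2⟩, by simp⟩)
  have hfib : ∀ p, φ p = v → p = x ∨ p = y := by
    intro p hp
    rcases hcases p with h1 | h1 | ⟨a, rfl⟩
    · exact .inl h1
    · exact .inr h1
    · exact absurd ((hφe a).symm.trans hp) a.2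
  have hinj : ∀ p q, φ p = φ q → φ p ≠ v → p = q := by
    intro p q hpq hp
    rcases hcases p with rfl | rfl | ⟨a, rfl⟩
    · exact absurd hφx hp
    · exact absurd hφy hp
    rcases hcases q with rfl | rfl | ⟨b, rfl⟩
    · exact absurd (hpq.trans hφx) hp
    · exact absurd (hpq.trans hφy) hp
    rw [hφe, hφe] at hpq
    rw [Subtype.ext hpq]
  have hva : ∀ a : {u : V // u ≠ v}, G.Adj v a ↔ G'.Adj x (e a) ∨ G'.Adj y (e a) := by
    intro a
    by_cases hva : G.Adj v a
    · exact ⟨fun _ => (hv a hva).imp And.left And.left, fun _ => hva⟩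
    · exact ⟨fun h => absurd h hva, fun h => (h.elim (hnv a hva).1 (hnv a hva).2).elim⟩
  have hvq : ∀ a, (G'.Adj x (e a) ∨ G'.Adj y (e a)) ↔ ∃ p, φ p = v ∧ G'.Adj p (e a) := by
    refine fun a => ⟨?_, ?_⟩
    · rintro (h | h)
      · exact ⟨x, hφx, h⟩
      · exact ⟨y, hφy, h⟩
    · rintro ⟨p, hp, h⟩
      rcases hfib p hp with rfl | rfl
      · exact .inl h
      · exact .inr h
  refine ⟨φ, ⟨fun s => ?_, fun p q hpq hne => ?_, fun p q hpq hne => ?_, fun s t hst => ?_⟩,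
    hφx, hφy, hfib, hinj⟩
  · by_cases hs : s = v
    · exact ⟨x, hφx.trans hs.symm⟩
    · exact ⟨e ⟨s, hs⟩, hφe _⟩
  · by_cases hp : φ p = v
    · rcases hfib p hp with rfl | rfl <;> rcases hfib q (hpq ▸ hp) with rfl | rfl
      · exact absurd rfl hne
      · exact hxy
      · exact hxy.symm
      · exact absurd rfl hne
    · exact absurd (hinj p q hpq hp) hne
  · have hvl : ∀ p q, G'.Adj p q → φ p = v → φ q ≠ v → G.Adj (φ p) (φ q) := by
      intro p q hpq hp hq
      rcases hcases q with rfl | rfl | ⟨a, rfl⟩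
      · exact absurd hφx hq
      · exact absurd hφy hq
      rw [hp, hφe, hva, hvq]
      exact ⟨p, hp, hpq⟩
    by_cases hp : φ p = v
    · exact hvl p q hpq hp fun hq => hne (hp.trans hq.symm)
    by_cases hq : φ q = v
    · exact (hvl q p hpq.symm hq hp).symm
    rcases hcases p with rfl | rfl | ⟨a, rfl⟩
    · exact absurd hφx hp
    · exact absurd hφy hp
    rcases hcases q with rfl | rfl | ⟨b, rfl⟩
    · exact absurd hφx hq
    · exact absurd hφy hq
    rw [hφe, hφe, ← he]
    exact hpq
  · by_cases hs : s = v
    · subst hs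
      obtain ⟨p, hp, hpq⟩ := (hvq ⟨t, hst.ne'⟩).1 ((hva ⟨t, hst.ne'⟩).1 hst)
      exact ⟨p, _, hp, hφe _, hpq⟩
    by_cases ht : t = v
    · subst ht
      obtain ⟨p, hp, hpq⟩ := (hvq ⟨s, hs⟩).1 ((hva ⟨s, hs⟩).1 hst.symm)
      exact ⟨_, p, hφe _, hp, hpq.symm⟩
    exact ⟨e ⟨s, hs⟩, e ⟨t, ht⟩, hφe _, hφe _, (he _ _).2 hst⟩

end Contraction

/-! ### Assembling the theorem. -/

theorem exists_adj_ne {V : Type*} {G : SimpleGraph V} {x y : V}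
    (hx : 3 ≤ (G.neighborSet x).encard) : ∃ z, z ≠ y ∧ G.Adj x z := by
  by_contra! h
  have h1 : (G.neighborSet x).encard ≤ 1 := by
    rw [← Set.encard_singleton y]
    refine Set.encard_le_encard fun z hz => ?_
    by_contra hzy
    exact h z hzy hz
  exact absurd (hx.trans h1) (by norm_num)

end MinorReconfiguration

open MinorReconfiguration in
theorem mainTheorem6 {V V' : Type*} [Finite V] [Finite V']
    (G : SimpleGraph V) (G' : SimpleGraph V') (v : V) (x y : V')
    (hG : MinorReconfiguration.IsKConnected 4 G)
    (hhost : MinorReconfiguration.InHost (SimpleGraph.completeGraph (Fin 4)) G)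
    (hG' : MinorReconfiguration.IsKConnected 4 G')
    (hsplit : MinorReconfiguration.IsVertexSplit G G' v x y) :
    MinorReconfiguration.InHost (SimpleGraph.completeGraph (Fin 4)) G' := by
  obtain ⟨φ, hφ, hφx, hφy, hfib, hinj⟩ := hsplit.exists_contraction
  have lift : ∀ f, IsK4Model G' f → f x = f y → ∃ g, IsK4Model G g ∧ f = g ∘ φ := by
    intro f hf hfxy
    have hfac : ∃ g : V → Fin 4, f = g ∘ φ := by
      refine (Function.factorsThrough_iff f).1 fun p q hpq => ?_
      by_cases hp : φ p = v
      · rcases hfib p hp with rfl | rfl <;> rcases hfib q (hpq ▸ hp) with rfl | rfl <;>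
          simp [hfxy]
      · rw [hinj p q hpq hp]
    obtain ⟨g, rfl⟩ := hfac
    exact ⟨g, hφ.isK4Model_comp.1 hf, rfl⟩
  obtain ⟨⟨g₀, hg₀⟩⟩ := hhost.nonempty
  have hg₀' := hφ.isK4Model_comp.2 hg₀
  have reach : ∀ f, IsK4Model G' f → Reconfigurable G' f (g₀ ∘ φ) := by
    intro f hf
    obtain ⟨f₁, h₁, hxy⟩ := hf.merge hG' hsplit.1
    obtain ⟨g, hg, rfl⟩ := lift f₁ h₁.right hxy
    refine h₁.trans (hφ.reconfigurable_comp hsplit.1 (hφx.trans hφy.symm) ?_ ?_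
      (exists_adj_ne hsplit.2.1) (exists_adj_ne hsplit.2.2.1)
      ⟨hg, hg₀, hhost.preconnected _ _⟩)
    · rwa [hφx]
    · rwa [hφx]
  refine (SimpleGraph.connected_iff_exists_forall_reachable _).2 ⟨⟨g₀ ∘ φ, hg₀'⟩, fun f => ?_⟩
  obtain ⟨_, _, h⟩ := (reach f.1 f.2).symm
  exact h
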